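/- Let $K$ be an algebraically closed field of characteristic zero and let $S=K[x_1,\dots,x_n]$. A linear form (quadratic form) is a homogeneous polynomial in $S$ of degree $1$ (degree $2$), the zero polynomial included. Let $Q_1,Q_2,P_1,\dots,P_k\in S$ be quadratic forms such that $\prod_{i=1}^k P_i$ lies in the radical of the ideal $(Q_1,Q_2)$ of $S$. Then at least one of the following holds: 1. There is $i\in\{1,\dots,k\}$ such that $P_i$ lies in the $K$-linear span of $Q_1$ and $Q_2$. 2. There are $\alpha,\beta\in K$, not both zero, and non-zero linear forms $x,y\in S$ (possibly proportional) such that $\alpha Q_1+\beta Q_2=xy$. 3. There are two linear forms $x,y\in S$ such that $Q_1$, $Q_2$ and $\prod_{i=1}^k P_i$ all belong to the ideal $(x,y)$. -/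

import Mathlib

/-! Suppose all three alternatives fail. If `Q₁` and `Q₂` are dependent, the ideal is generated by
one quadric, which is zero or prime since it has no linear factor, and some `P i` lies in it.
Otherwise no nontrivial combination of `Q₁`, `Q₂` has a linear factor, and no ideal `(x, y)` of
linear forms with `x ≠ 0` contains both: such an ideal is radical, so it would also contain the
product.

Then there is a common zero `p` at which `Q₁` is smooth (`exists_smooth_common_zero`). With `ξ(p) =
1`, write `Q₁ = ξ l + q₁` and `Q₂ = ξ m + q₂`, where `l, m, q₁, q₂` are invariant under translation
by `p` and `l ≠ 0`. Projecting the base locus from `p` eliminates `ξ` and leaves the cubic `F = l q₂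
- m q₁`. If `l ∤ m`, a linear factor of `F` would contradict one of the two conditions, so `F` is
prime. If `m = r l`, replacing `Q₂` by the cone `q₂ - r q₁` with vertex `p` makes that quadric the
prime `F`. Solving for `ξ` in the fraction field of `S/(F)` kills `Q₁` and `Q₂`, hence some `P i`.
The resulting divisibility by `F`, read modulo `l`, puts `P i` in `(Q₁, Q₂)`; comparing degrees puts
it in the linear span. -/

namespace MvPolynomial

variable {σ K : Type*} [Field K]

/-! ### Homogeneous components and factors of forms. -/

/-- The homomorphism `X i ↦ X i * T`, which records the homogeneous components as coefficients. -/
noncomputable def gradeHom : MvPolynomial σ K →ₐ[K] Polynomial (MvPolynomial σ K) :=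
  aeval fun i => Polynomial.C (X i) * Polynomial.X

theorem gradeHom_monomial (d : σ →₀ ℕ) (r : K) :
    gradeHom (monomial d r) = Polynomial.C (monomial d r) * Polynomial.X ^ d.degree := by
  rw [gradeHom, aeval_monomial, Finsupp.prod]
  simp only [mul_pow, Finset.prod_mul_distrib]
  rw [Finset.prod_pow_eq_pow_sum, monomial_eq, Finsupp.prod, map_mul, map_prod, ← mul_assoc]
  simp only [map_pow]
  rfl

theorem IsHomogeneous.gradeHom_eq {f : MvPolynomial σ K} {d : ℕ} (hf : f.IsHomogeneous d) :
    gradeHom f = Polynomial.C f * Polynomial.X ^ d := by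
  conv_lhs => rw [f.as_sum]
  conv_rhs => rw [f.as_sum]
  rw [map_sum, map_sum, Finset.sum_mul]
  refine Finset.sum_congr rfl fun e he => ?_
  rw [gradeHom_monomial, hf.degree_eq_sum_deg_support he]
  rfl

theorem coeff_gradeHom (f : MvPolynomial σ K) (d : ℕ) :
    (gradeHom f).coeff d = homogeneousComponent d f := by
  conv_lhs => rw [← sum_homogeneousComponent f]
  rw [map_sum, Polynomial.finsetSum_coeff]
  simp only [(homogeneousComponent_isHomogeneous _ f).gradeHom_eq, Polynomial.coeff_C_mul_X_pow]
  rw [Finset.sum_ite_eq]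
  split_ifs with h
  · rfl
  · rw [homogeneousComponent_eq_zero]
    simpa using h

theorem homogeneousComponent_mul_of_isHomogeneous {f g : MvPolynomial σ K} {a b : ℕ}
    (hg : g.IsHomogeneous b) :
    homogeneousComponent (a + b) (f * g) = homogeneousComponent a f * g := by
  rw [← coeff_gradeHom, ← coeff_gradeHom, map_mul, hg.gradeHom_eq, ← mul_assoc,
    Polynomial.coeff_mul_X_pow, Polynomial.coeff_mul_C]

theorem isHomogeneous_of_gradeHom_natTrailingDegree {f : MvPolynomial σ K}
    (h : (gradeHom f).natTrailingDegree = (gradeHom f).natDegree) :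
    f.IsHomogeneous (gradeHom f).natDegree := by
  have key : ∀ d, d ≠ (gradeHom f).natDegree → homogeneousComponent d f = 0 := by
    intro d hd
    rw [← coeff_gradeHom]
    rcases lt_or_gt_of_ne hd with hd | hd
    · exact Polynomial.coeff_eq_zero_of_lt_natTrailingDegree (h ▸ hd)
    · exact Polynomial.coeff_eq_zero_of_natDegree_lt hd
  rw [← sum_homogeneousComponent f]
  refine IsHomogeneous.sum _ _ _ fun d _ => ?_
  by_cases hd : d = (gradeHom f).natDegree
  · rw [sum_homogeneousComponent, ← hd]
    exact homogeneousComponent_isHomogeneous _ _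
  · rw [key d hd]
    exact isHomogeneous_zero _ _ _

theorem gradeHom_ne_zero {f : MvPolynomial σ K} (hf : f ≠ 0) : gradeHom f ≠ 0 := by
  intro h
  apply hf
  rw [← sum_homogeneousComponent f]
  refine Finset.sum_eq_zero fun d _ => ?_
  rw [← coeff_gradeHom, h, Polynomial.coeff_zero]

/-- Factors of a nonzero homogeneous polynomial are homogeneous. -/
theorem IsHomogeneous.exists_of_mul {f g : MvPolynomial σ K} {d : ℕ}
    (h : (f * g).IsHomogeneous d) (h0 : f * g ≠ 0) :
    ∃ a b, a + b = d ∧ f.IsHomogeneous a ∧ g.IsHomogeneous b := by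
  have hf := gradeHom_ne_zero (left_ne_zero_of_mul h0)
  have hg := gradeHom_ne_zero (right_ne_zero_of_mul h0)
  have e := h.gradeHom_eq
  rw [map_mul] at e
  -- Top and bottom degrees in `T` both add up over a product; they agree for `f * g`, hence for
  -- each factor.
  have e1 := congrArg Polynomial.natDegree e
  have e2 := congrArg Polynomial.natTrailingDegree e
  rw [Polynomial.natDegree_mul hf hg, Polynomial.natDegree_C_mul_X_pow _ _ h0] at e1
  rw [Polynomial.natTrailingDegree_mul hf hg, Polynomial.C_mul_X_pow_eq_monomial,
    Polynomial.natTrailingDegree_monomial h0] at e2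
  have t1 := (gradeHom f).natTrailingDegree_le_natDegree
  have t2 := (gradeHom g).natTrailingDegree_le_natDegree
  exact ⟨_, _, e1, isHomogeneous_of_gradeHom_natTrailingDegree (by omega),
    isHomogeneous_of_gradeHom_natTrailingDegree (by omega)⟩

theorem IsHomogeneous.right_of_mul {f g : MvPolynomial σ K} {a b : ℕ} (hf : f.IsHomogeneous a)
    (hf0 : f ≠ 0) (h : (f * g).IsHomogeneous (a + b)) : g.IsHomogeneous b := by
  by_cases hg : g = 0
  · rw [hg]; exact isHomogeneous_zero _ _ _
  obtain ⟨a', b', e, ha, hb⟩ := h.exists_of_mul (mul_ne_zero hf0 hg)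
  have := hf.inj_right ha hf0
  obtain rfl : b' = b := by omega
  exact hb

theorem IsHomogeneous.exists_eq_C {f : MvPolynomial σ K} (hf : f.IsHomogeneous 0) :
    ∃ r, f = C r :=
  ⟨_, totalDegree_eq_zero_iff_eq_C.1 (Nat.le_zero.1 hf.totalDegree_le)⟩

theorem IsHomogeneous.eq_zero_of_dvd {f g : MvPolynomial σ K} {a b : ℕ} (hf : f.IsHomogeneous a)
    (hg : g.IsHomogeneous b) (hab : b < a) (h : f ∣ g) : g = 0 := by
  by_contra hg0
  obtain ⟨k, rfl⟩ := h
  obtain ⟨a', b', e, ha, -⟩ := hg.exists_of_mul hg0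
  have := hf.inj_right ha (left_ne_zero_of_mul hg0)
  omega

theorem IsHomogeneous.not_isUnit {f : MvPolynomial σ K} {a : ℕ} (hf : f.IsHomogeneous a)
    (ha : 0 < a) : ¬ IsUnit f := fun h =>
  one_ne_zero (hf.eq_zero_of_dvd (isHomogeneous_one σ K) ha h.dvd)

theorem IsHomogeneous.mem_span_pair {P Q₁ Q₂ : MvPolynomial σ K} {d : ℕ} (hP : P.IsHomogeneous d)
    (h₁ : Q₁.IsHomogeneous d) (h₂ : Q₂.IsHomogeneous d) (h : P ∈ Ideal.span {Q₁, Q₂}) :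
    P ∈ Submodule.span K {Q₁, Q₂} := by
  obtain ⟨A, B, e⟩ := Ideal.mem_span_pair.1 h
  -- In degree `d` only the constant terms of the multipliers survive.
  refine Submodule.mem_span_pair.2 ⟨coeff 0 A, coeff 0 B, ?_⟩
  have e' := congrArg (homogeneousComponent (0 + d)) e
  rw [map_add, homogeneousComponent_mul_of_isHomogeneous h₁,
    homogeneousComponent_mul_of_isHomogeneous h₂, homogeneousComponent_zero,
    homogeneousComponent_zero, zero_add, homogeneousComponent_eq_self hP] at e'
  rw [smul_eq_C_mul, smul_eq_C_mul, e']

theorem linear_induction {p : MvPolynomial σ K → Prop} (hX : ∀ i, p (X i)) (h0 : p 0)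
    (hadd : ∀ f g, p f → p g → p (f + g)) (hsmul : ∀ (r : K) f, p f → p (C r * f))
    {f : MvPolynomial σ K} (hf : f.IsHomogeneous 1) : p f := by
  have : f ∈ homogeneousSubmodule σ K 1 := hf
  rw [homogeneousSubmodule_one_eq_span_X] at this
  clear hf
  induction this using Submodule.span_induction with
  | mem x h => obtain ⟨i, rfl⟩ := h; exact hX i
  | zero => exact h0
  | add x y _ _ hx hy => exact hadd x y hx hy
  | smul r x _ hx => rw [smul_eq_C_mul]; exact hsmul r x hx

theorem quadratic_induction {p : MvPolynomial σ K → Prop}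
    (hmul : ∀ f g : MvPolynomial σ K, f.IsHomogeneous 1 → g.IsHomogeneous 1 → p (f * g))
    (hadd : ∀ f g, p f → p g → p (f + g))
    {f : MvPolynomial σ K} (hf : f.IsHomogeneous 2) : p f := by
  have : f ∈ homogeneousSubmodule σ K 2 := hf
  rw [← homogeneousSubmodule_one_pow, pow_two] at this
  clear hf
  induction this using Submodule.mul_induction_on' with
  | mem_mul_mem x hx y hy => exact hmul x y hx hy
  | add x _ y _ hx hy => exact hadd x y hx hy

end MvPolynomial

/-! ### Projection along a point, and reduction modulo a linear form. -/

namespace MvPolynomial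

variable {σ K : Type*} [Field K]

/-- The substitution `v ↦ v - ξ(v) p`. -/
noncomputable def slide (p : σ → K) (ξ : MvPolynomial σ K) : MvPolynomial σ K →ₐ[K] MvPolynomial σ K :=
  aeval fun j => X j - C (p j) * ξ

variable {p : σ → K} {ξ : MvPolynomial σ K}

theorem slide_X (j : σ) : slide p ξ (X j) = X j - C (p j) * ξ := aeval_X _ _

theorem slide_linear {f : MvPolynomial σ K} (hf : f.IsHomogeneous 1) :
    slide p ξ f = f - C (eval p f) * ξ := by
  refine linear_induction (p := fun f => slide p ξ f = f - C (eval p f) * ξ)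
    (fun i => ?_) ?_ (fun f g hf hg => ?_) (fun r f hf => ?_) hf
  · rw [slide_X, eval_X]
  · simp
  · simp only [map_add, hf, hg]; ring
  · simp only [map_mul, hf, algHom_C, algebraMap_eq, eval_C]; ring

theorem slide_self (hξ : ξ.IsHomogeneous 1) (h1 : eval p ξ = 1) : slide p ξ ξ = 0 := by
  rw [slide_linear hξ, h1]; simp

theorem dvd_sub_slide (f : MvPolynomial σ K) : ξ ∣ f - slide p ξ f := by
  induction f using MvPolynomial.induction_on with
  | C a => simp
  | add f g hf hg =>
    rw [map_add, add_sub_add_comm]; exact dvd_add hf hg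
  | mul_X f i hf =>
    rw [map_mul, slide_X]
    have : f * X i - slide p ξ f * (X i - C (p i) * ξ) =
      (f - slide p ξ f) * X i + ξ * (slide p ξ f * C (p i)) := by ring
    rw [this]
    exact dvd_add (dvd_mul_of_dvd_left hf _) (dvd_mul_right _ _)

theorem slide_eq_zero_iff (hξ : ξ.IsHomogeneous 1) (h1 : eval p ξ = 1) {f : MvPolynomial σ K} :
    slide p ξ f = 0 ↔ ξ ∣ f := by
  constructor
  · intro h
    have := dvd_sub_slide (p := p) (ξ := ξ) f
    rwa [h, sub_zero] at this
  · rintro ⟨g, rfl⟩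
    rw [map_mul, slide_self hξ h1, zero_mul]

theorem slide_slide (hξ : ξ.IsHomogeneous 1) (h1 : eval p ξ = 1) (f : MvPolynomial σ K) :
    slide p ξ (slide p ξ f) = slide p ξ f := by
  rw [← sub_eq_zero, ← map_sub, slide_eq_zero_iff hξ h1, dvd_sub_comm]
  exact dvd_sub_slide f

theorem IsHomogeneous.slide (hξ : ξ.IsHomogeneous 1) {f : MvPolynomial σ K} {d : ℕ}
    (hf : f.IsHomogeneous d) : (slide p ξ f).IsHomogeneous d := by
  have := hf.aeval (fun j => X j - C (p j) * ξ) (n := 1)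
    (fun j => (isHomogeneous_X _ _).sub (hξ.C_mul _))
  rwa [one_mul] at this

theorem eval_slide (p v : σ → K) (f : MvPolynomial σ K) :
    eval v (MvPolynomial.slide p ξ f) = eval (fun j => v j - p j * eval v ξ) f := by
  induction f using MvPolynomial.induction_on with
  | C a => simp
  | add f g hf hg => simp only [map_add, hf, hg]
  | mul_X f i hf => simp [hf, slide_X]

theorem exists_eval_eq_one {h : MvPolynomial σ K} (hh : h.IsHomogeneous 1) (h0 : h ≠ 0) :
    ∃ p : σ → K, eval p h = 1 := by
  classical
  by_contra! H
  apply h0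
  have key : ∀ i, eval (Pi.single i 1) h = 0 := by
    intro i
    by_contra hi
    apply H (fun j => (eval (Pi.single i 1) h)⁻¹ * Pi.single (M := fun _ => K) i 1 j)
    have : ∀ (r : K) (v : σ → K), eval (fun j => r * v j) h = r * eval v h := by
      intro r v
      refine linear_induction (p := fun f => eval (fun j => r * v j) f = r * eval v f)
        (fun i => by simp) (by simp) (fun f g hf hg => ?_) (fun s f hf => ?_) hh
      · simp only [map_add, hf, hg, mul_add]
      · simp only [map_mul, eval_C, hf]; ring
    rw [this, inv_mul_cancel₀ hi]
  ext d
  rw [coeff_zero]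
  by_cases hd : d.degree = 1
  · obtain ⟨i, rfl⟩ := (Finsupp.sum_eq_one_iff d).1 hd
    rw [← key i]
    refine linear_induction
      (p := fun f => coeff (Finsupp.single i 1) f = eval (Pi.single i 1) f)
      (fun j => ?_) (by simp) (fun f g hf hg => ?_) (fun s f hf => ?_) hh
    · rw [eval_X, coeff_X, Pi.single_apply]
      simp [Finsupp.single_left_inj]
    · simp only [coeff_add, map_add, hf, hg]
    · simp only [coeff_C_mul, map_mul, eval_C, hf]
  · exact hh.coeff_eq_zero hd

/-- Reduction modulo a linear form, realised inside the polynomial ring. -/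
theorem exists_retraction {h : MvPolynomial σ K} (hh : h.IsHomogeneous 1) (h0 : h ≠ 0) :
    ∃ ψ : MvPolynomial σ K →ₐ[K] MvPolynomial σ K, (∀ f, ψ f = 0 ↔ h ∣ f) ∧ (∀ f, h ∣ f - ψ f) ∧
      ∀ f d, f.IsHomogeneous d → (ψ f).IsHomogeneous d := by
  obtain ⟨p, hp⟩ := exists_eval_eq_one hh h0
  exact ⟨slide p h, fun f => slide_eq_zero_iff hh hp, dvd_sub_slide,
    fun f d hf => IsHomogeneous.slide hh hf⟩

theorem IsHomogeneous.prime_of_linear {h : MvPolynomial σ K} (hh : h.IsHomogeneous 1)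
    (h0 : h ≠ 0) : Prime h := by
  obtain ⟨ψ, hψ, -, -⟩ := exists_retraction hh h0
  refine ⟨h0, hh.not_isUnit one_pos, fun a b hab => ?_⟩
  rw [← hψ, map_mul, mul_eq_zero, hψ, hψ] at hab
  exact hab

/-- The ideal generated by two linear forms is radical. -/
theorem mem_span_pair_of_pow_mem {x y f : MvPolynomial σ K} (hx : x.IsHomogeneous 1) (hx0 : x ≠ 0)
    (hy : y.IsHomogeneous 1) {N : ℕ} (h : f ^ N ∈ Ideal.span {x, y}) : f ∈ Ideal.span {x, y} := by
  obtain ⟨ψ, hψ, hsub, hhom⟩ := exists_retraction hx hx0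
  obtain ⟨a, b, e⟩ := Ideal.mem_span_pair.1 h
  have e' := congrArg ψ e
  rw [map_add, map_mul, map_mul, (hψ x).2 dvd_rfl, mul_zero, zero_add, map_pow] at e'
  -- Modulo `x`, the form `y` becomes zero or a prime linear form.
  have key : ψ y ∣ ψ f := by
    by_cases h0 : ψ y = 0
    · rw [h0, mul_zero] at e'
      rw [h0, zero_dvd_iff]
      exact eq_zero_of_pow_eq_zero e'.symm
    · exact (IsHomogeneous.prime_of_linear (hhom y 1 hy) h0).dvd_of_dvd_pow (e' ▸ dvd_mul_left _ _)
  obtain ⟨c, hc⟩ := key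
  obtain ⟨u, hu⟩ := hsub f
  obtain ⟨v, hv⟩ := hsub y
  refine Ideal.mem_span_pair.2 ⟨u - v * c, c, ?_⟩
  linear_combination -hu - hc + c * hv

/-- A form of degree two or three without linear factor is prime. -/
theorem IsHomogeneous.prime_of_no_linear_factor {Q : MvPolynomial σ K} {d : ℕ}
    (hQ : Q.IsHomogeneous d) (h2 : 2 ≤ d) (h3 : d ≤ 3)
    (h : ∀ x : MvPolynomial σ K, x.IsHomogeneous 1 → ¬ x ∣ Q) : Prime Q := by
  have h0 : Q ≠ 0 := by rintro rfl; exact h 0 (isHomogeneous_zero _ _ _) dvd_rfl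
  refine Irreducible.prime ⟨hQ.not_isUnit (by omega), fun a b e => ?_⟩
  subst e
  obtain ⟨i, j, hij, ha, hb⟩ := hQ.exists_of_mul h0
  have hi : i ≠ 1 := by rintro rfl; exact h a ha (dvd_mul_right _ _)
  have hj : j ≠ 1 := by rintro rfl; exact h b hb (dvd_mul_left _ _)
  have unit : ∀ f : MvPolynomial σ K, f.IsHomogeneous 0 → f ≠ 0 → IsUnit f := by
    intro f hf hf0
    obtain ⟨r, rfl⟩ := hf.exists_eq_C
    exact (isUnit_iff_ne_zero.2 (by rintro rfl; simp at hf0)).map C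
  obtain rfl | rfl : i = 0 ∨ j = 0 := by omega
  · exact Or.inl (unit a ha (left_ne_zero_of_mul h0))
  · exact Or.inr (unit b hb (right_ne_zero_of_mul h0))

/-- Expansion of a quadratic form around the point `p`. -/
theorem exists_expansion {f : MvPolynomial σ K} (hξ : ξ.IsHomogeneous 1)
    (h1 : eval p ξ = 1) (hf : f.IsHomogeneous 2) :
    ∃ b c, b.IsHomogeneous 1 ∧ c.IsHomogeneous 2 ∧ MvPolynomial.slide p ξ b = b ∧
      MvPolynomial.slide p ξ c = c ∧ f = C (eval p f) * ξ ^ 2 + ξ * b + c := by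
  refine quadratic_induction (p := fun f => ∃ b c, b.IsHomogeneous 1 ∧ c.IsHomogeneous 2 ∧
    MvPolynomial.slide p ξ b = b ∧ MvPolynomial.slide p ξ c = c ∧
      f = C (eval p f) * ξ ^ 2 + ξ * b + c) (fun f g hf hg => ?_) ?_ hf
  · have ef := slide_linear (p := p) (ξ := ξ) hf
    have eg := slide_linear (p := p) (ξ := ξ) hg
    have hf' := IsHomogeneous.slide (p := p) hξ hf
    have hg' := IsHomogeneous.slide (p := p) hξ hg
    refine ⟨C (eval p f) * MvPolynomial.slide p ξ g + C (eval p g) * MvPolynomial.slide p ξ f,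
      MvPolynomial.slide p ξ f * MvPolynomial.slide p ξ g,
      (hg'.C_mul _).add (hf'.C_mul _), hf'.mul hg', ?_, ?_, ?_⟩
    · simp only [map_add, map_mul, slide_slide hξ h1, algHom_C, algebraMap_eq]
    · simp only [map_mul, slide_slide hξ h1]
    · rw [map_mul (eval p), map_mul C, ef, eg]; ring
  · rintro f g ⟨b, c, hb, hc, sb, sc, e⟩ ⟨b', c', hb', hc', sb', sc', e'⟩
    refine ⟨b + b', c + c', hb.add hb', hc.add hc', by rw [map_add, sb, sb'],
      by rw [map_add, sc, sc'], ?_⟩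
    rw [map_add, C_add]; linear_combination e + e'

end MvPolynomial

/-! ### Eliminating `ξ`: projection of the pencil from a common zero. -/

namespace MvPolynomial

variable {σ K : Type*} [Field K] {p : σ → K} {ξ : MvPolynomial σ K}

/-- A homomorphism to a `K`-algebra may be modified on `ξ` freely, without changing it on the
polynomials invariant under translation by `p`. -/
theorem exists_algHom_extension {L : Type*} [CommRing L] [Algebra K L] (hξ : ξ.IsHomogeneous 1)
    (h1 : eval p ξ = 1) (π : MvPolynomial σ K →ₐ[K] L) (t : L) :
    ∃ θ : MvPolynomial σ K →ₐ[K] L, θ ξ = t ∧ ∀ f, slide p ξ f = f → θ f = π f := by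
  -- Each variable is `X j = (X j - p j ξ) + p j ξ`: the first summand is invariant and follows `π`,
  -- while `ξ` goes to `t`.
  let θ : MvPolynomial σ K →ₐ[K] L :=
    aeval fun j => π (slide p ξ (X j)) + algebraMap K L (p j) * t
  have hlin : ∀ f : MvPolynomial σ K, f.IsHomogeneous 1 →
      θ f = π (slide p ξ f) + algebraMap K L (eval p f) * t := by
    intro f hf
    refine linear_induction
      (p := fun f => θ f = π (slide p ξ f) + algebraMap K L (eval p f) * t)
      (fun i => ?_) (by simp) (fun f g hf hg => ?_) (fun r f hf => ?_) hf
    · rw [eval_X]; exact aeval_X _ _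
    · simp only [map_add, hf, hg]; ring
    · simp only [map_mul, hf, algHom_C, eval_C, AlgHom.commutes]; ring
  have hξ' : θ ξ = t := by rw [hlin ξ hξ, slide_self hξ h1, h1]; simp
  have hcomp : θ.comp (slide p ξ) = π.comp (slide p ξ) := by
    apply algHom_ext
    intro j
    rw [AlgHom.comp_apply, AlgHom.comp_apply]
    conv_lhs => rw [slide_X]
    rw [map_sub, map_mul, hξ', algHom_C, hlin _ (isHomogeneous_X _ _), eval_X]
    ring
  refine ⟨θ, hξ', fun f hf => ?_⟩
  have := DFunLike.congr_fun hcomp f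
  rwa [AlgHom.comp_apply, AlgHom.comp_apply, hf] at this

/-- Over the function field of `F = 0`, the value `ξ = -q₂ / m` is a common root of `Q₁` and `Q₂`,
hence a root of some `P i`; clearing the denominator `m ^ 2` gives the divisibility. -/
theorem exists_dvd_resultant {ι : Type*} {s : Finset ι} (hξ : ξ.IsHomogeneous 1)
    (h1 : eval p ξ = 1) {F l m q₁ q₂ Q₁ Q₂ : MvPolynomial σ K} {P : ι → MvPolynomial σ K}
    (hF : Prime F) (hm : ¬ F ∣ m) (hdvd : F ∣ l * q₂ - m * q₁)
    (sl : slide p ξ l = l) (sm : slide p ξ m = m)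
    (sq₁ : slide p ξ q₁ = q₁) (sq₂ : slide p ξ q₂ = q₂)
    (e₁ : Q₁ = ξ * l + q₁) (e₂ : Q₂ = ξ * m + q₂) (hP : ∀ i, (P i).IsHomogeneous 2)
    (hrad : (∏ i ∈ s, P i) ∈ (Ideal.span {Q₁, Q₂}).radical) :
    ∃ i ∈ s, ∃ (a : K) (b c : MvPolynomial σ K), b.IsHomogeneous 1 ∧ c.IsHomogeneous 2 ∧
      P i = C a * ξ ^ 2 + ξ * b + c ∧ F ∣ C a * q₂ ^ 2 - m * q₂ * b + m ^ 2 * c := by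
  have hprime : (Ideal.span {F}).IsPrime := (Ideal.span_singleton_prime hF.ne_zero).2 hF
  let A := MvPolynomial σ K ⧸ Ideal.span {F}
  let L := FractionRing A
  let π : MvPolynomial σ K →ₐ[K] L :=
    (IsScalarTower.toAlgHom K A L).comp (Ideal.Quotient.mkₐ K (Ideal.span {F}))
  have hπ : ∀ f, π f = 0 ↔ F ∣ f := by
    intro f
    change algebraMap A L (Ideal.Quotient.mk _ f) = 0 ↔ _
    rw [FaithfulSMul.algebraMap_eq_zero_iff, Ideal.Quotient.eq_zero_iff_mem,
      Ideal.mem_span_singleton]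
  have hm' : π m ≠ 0 := fun h => hm ((hπ m).1 h)
  have hd' : π l * π q₂ = π m * π q₁ := by
    rw [← map_mul, ← map_mul, ← sub_eq_zero, ← map_sub]; exact (hπ _).2 hdvd
  obtain ⟨t, ht⟩ : ∃ t : L, t * π m = -π q₂ := ⟨-π q₂ / π m, div_mul_cancel₀ _ hm'⟩
  obtain ⟨θ, hθ, hθs⟩ := exists_algHom_extension hξ h1 π t
  have h₁ : θ Q₁ = 0 := by
    rw [e₁, map_add, map_mul, hθ, hθs l sl, hθs q₁ sq₁]; 
    apply mul_left_cancel₀ hm'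
    linear_combination π l * ht - hd'
  have h₂ : θ Q₂ = 0 := by
    rw [e₂, map_add, map_mul, hθ, hθs m sm, hθs q₂ sq₂]; 
    linear_combination ht
  obtain ⟨N, hN⟩ := hrad
  obtain ⟨u, v, huv⟩ := Ideal.mem_span_pair.1 hN
  have h0 := congrArg θ huv
  rw [map_add, map_mul, map_mul, h₁, h₂, mul_zero, mul_zero, add_zero, map_pow, map_prod] at h0
  obtain ⟨i, hi, hi0⟩ := Finset.prod_eq_zero_iff.1 (eq_zero_of_pow_eq_zero h0.symm)
  obtain ⟨b, c, hb, hc, sb, sc, e⟩ := exists_expansion hξ h1 (hP i)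
  refine ⟨i, hi, _, b, c, hb, hc, e, (hπ _).1 ?_⟩
  rw [e, map_add, map_add, map_mul, map_mul, map_pow, hθ, hθs b sb, hθs c sc, algHom_C] at hi0
  rw [map_add, map_sub, map_mul, map_mul, map_mul, map_mul, map_pow, map_pow, algHom_C]
  linear_combination π m ^ 2 * hi0 - (algebraMap K L _ * (t * π m - π q₂) + π m * π b) * ht

/-- The case of two quadrics whose tangent hyperplanes at the common zero `p` are distinct. -/
theorem exists_mem_of_isRelPrime_tangents {ι : Type*} {s : Finset ι} (hξ : ξ.IsHomogeneous 1)
    (h1 : eval p ξ = 1) {l m q₁ q₂ Q₁ Q₂ : MvPolynomial σ K} {P : ι → MvPolynomial σ K}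
    (hl : l.IsHomogeneous 1) (hm : m.IsHomogeneous 1) (hl0 : l ≠ 0) (hlm : ¬ l ∣ m)
    (hq₁ : q₁.IsHomogeneous 2) (hq₂ : q₂.IsHomogeneous 2)
    (sl : slide p ξ l = l) (sm : slide p ξ m = m)
    (sq₁ : slide p ξ q₁ = q₁) (sq₂ : slide p ξ q₂ = q₂)
    (e₁ : Q₁ = ξ * l + q₁) (e₂ : Q₂ = ξ * m + q₂) (hP : ∀ i, (P i).IsHomogeneous 2)
    (hrad : (∏ i ∈ s, P i) ∈ (Ideal.span {Q₁, Q₂}).radical)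
    (hpencil : ∀ (α β : K) (x : MvPolynomial σ K), α ≠ 0 ∨ β ≠ 0 → x.IsHomogeneous 1 →
      ¬ x ∣ C α * Q₁ + C β * Q₂)
    (hlinear : ∀ x y : MvPolynomial σ K, x.IsHomogeneous 1 → y.IsHomogeneous 1 → x ≠ 0 →
      ¬ (Q₁ ∈ Ideal.span {x, y} ∧ Q₂ ∈ Ideal.span {x, y})) :
    ∃ i ∈ s, P i ∈ Ideal.span {Q₁, Q₂} := by
  have hm0 : m ≠ 0 := by rintro rfl; exact hlm (dvd_zero _)
  have pl := hl.prime_of_linear hl0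
  have hF : (l * q₂ - m * q₁).IsHomogeneous 3 := (hl.mul hq₂).sub (hm.mul hq₁)
  have hFp : Prime (l * q₂ - m * q₁) := by
    refine hF.prime_of_no_linear_factor (by norm_num) le_rfl fun h hh hdvd => ?_
    by_cases hh0 : h = 0
    · subst hh0
      rw [zero_dvd_iff, sub_eq_zero] at hdvd
      have : l ∣ q₁ := (pl.dvd_or_dvd (hdvd ▸ dvd_mul_right l q₂)).resolve_left hlm
      refine hpencil 1 0 l (Or.inl one_ne_zero) hl ?_
      rw [e₁]; simpa using dvd_add (dvd_mul_left l ξ) this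
    obtain ⟨ψ, hψ, hsub, hhom⟩ := exists_retraction hh hh0
    have ph := hh.prime_of_linear hh0
    have e := (hψ _).2 hdvd
    rw [map_sub, map_mul, map_mul, sub_eq_zero] at e
    -- the case of `h` in the span of `l` and `m`
    have hspan : ∀ α β : K, α ≠ 0 ∨ β ≠ 0 → ¬ h ∣ C α * l + C β * m := by
      rintro α β hαβ hd
      -- Both `l` and `m` times this combination are divisible by the prime `h`, which cannot divide
      -- both `l` and `m`.
      have hd' : h ∣ C α * q₁ + C β * q₂ := by
        have k1 : h ∣ l * (C α * q₁ + C β * q₂) := by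
          have : l * (C α * q₁ + C β * q₂) =
            (C α * l + C β * m) * q₁ + C β * (l * q₂ - m * q₁) := by ring
          rw [this]; exact dvd_add (dvd_mul_of_dvd_left hd _) (dvd_mul_of_dvd_right hdvd _)
        have k2 : h ∣ m * (C α * q₁ + C β * q₂) := by
          have : m * (C α * q₁ + C β * q₂) =
            (C α * l + C β * m) * q₂ - C α * (l * q₂ - m * q₁) := by ring
          rw [this]; exact dvd_sub (dvd_mul_of_dvd_left hd _) (dvd_mul_of_dvd_right hdvd _)
        rcases ph.dvd_or_dvd k1 with k1 | k1
        · rcases ph.dvd_or_dvd k2 with k2 | k2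
          · exact absurd ((ph.irreducible.dvd_symm pl.irreducible k1).trans k2) hlm
          · exact k2
        · exact k1
      refine hpencil α β h hαβ hh ?_
      have : C α * Q₁ + C β * Q₂ = ξ * (C α * l + C β * m) + (C α * q₁ + C β * q₂) := by
        rw [e₁, e₂]; ring
      rw [this]
      exact dvd_add (dvd_mul_of_dvd_right hd _) hd'
    have hψl : ψ l ≠ 0 := fun h0 =>
      hspan 1 0 (Or.inl one_ne_zero) (by simpa using (hψ l).1 h0)
    have pψl := (hhom l 1 hl).prime_of_linear hψl
    have hnd : ¬ ψ l ∣ ψ m := by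
      rintro ⟨k, hk⟩
      obtain ⟨r, rfl⟩ := ((hhom l 1 hl).right_of_mul hψl (b := 0)
        (hk ▸ hhom m 1 hm)).exists_eq_C
      refine hspan (-r) 1 (Or.inr one_ne_zero) ((hψ _).1 ?_)
      rw [map_add, map_mul, map_mul, hk, algHom_C, algHom_C]
      simp [algebraMap_eq, mul_comm]
    -- Modulo `h`, `l` and `m` are coprime, so `q₁ = l c` and `q₂ = m c` for one `c`; then `Q₁` and
    -- `Q₂` lie in `(h, ξ + c)`.
    obtain ⟨c, hc⟩ : ψ l ∣ ψ q₁ :=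
      (pψl.dvd_or_dvd (e ▸ dvd_mul_right _ _)).resolve_left hnd
    have hc1 : c.IsHomogeneous 1 :=
      (hhom l 1 hl).right_of_mul hψl (hc ▸ hhom q₁ 2 hq₁)
    have hc2 : ψ q₂ = ψ m * c := by
      apply mul_left_cancel₀ hψl; rw [e, hc]; ring
    obtain ⟨u₁, hu₁⟩ := hsub q₁
    obtain ⟨u₂, hu₂⟩ := hsub q₂
    obtain ⟨v₁, hv₁⟩ := hsub l
    obtain ⟨v₂, hv₂⟩ := hsub m
    refine hlinear h (ξ + c) hh (hξ.add hc1) hh0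
      ⟨Ideal.mem_span_pair.2 ⟨u₁ - v₁ * c, l, ?_⟩, Ideal.mem_span_pair.2 ⟨u₂ - v₂ * c, m, ?_⟩⟩
    · rw [e₁]; linear_combination -hu₁ - hc + c * hv₁
    · rw [e₂]; linear_combination -hu₂ - hc2 + c * hv₂
  have hlF : ¬ l * q₂ - m * q₁ ∣ l := fun h => hl0 (hF.eq_zero_of_dvd hl (by norm_num) h)
  have hmF : ¬ l * q₂ - m * q₁ ∣ m := fun h => hm0 (hF.eq_zero_of_dvd hm (by norm_num) h)
  obtain ⟨i, hi, a, b, c, hb, hc, e, hR₂⟩ := exists_dvd_resultant hξ h1 hFp hmF dvd_rfl sl sm sq₁ sq₂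
    e₁ e₂ hP hrad
  refine ⟨i, hi, ?_⟩
  -- Modulo `F` one has `l q₂ = m q₁`, which exchanges the two quadrics up to the factors `l ^ 2`
  -- and `m ^ 2`.
  have hR₁ : l * q₂ - m * q₁ ∣ C a * q₁ ^ 2 - l * q₁ * b + l ^ 2 * c := by
    have : l * q₂ - m * q₁ ∣ m ^ 2 * (C a * q₁ ^ 2 - l * q₁ * b + l ^ 2 * c) := by
      have : m ^ 2 * (C a * q₁ ^ 2 - l * q₁ * b + l ^ 2 * c) =
        l ^ 2 * (C a * q₂ ^ 2 - m * q₂ * b + m ^ 2 * c) +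
        (l * q₂ - m * q₁) * (l * m * b - C a * (l * q₂ + m * q₁)) := by ring
      rw [this]
      exact dvd_add (dvd_mul_of_dvd_right hR₂ _) (dvd_mul_right _ _)
    exact (hFp.dvd_or_dvd this).resolve_left fun h => hmF (hFp.dvd_of_dvd_pow h)
  -- reduction modulo one of the tangent forms
  have mem_of_ne : ∀ {l m q₁ q₂ : MvPolynomial σ K}, l.IsHomogeneous 1 → l ≠ 0 → ¬ l ∣ q₁ →
      l * q₂ - m * q₁ ∣ C a * q₁ ^ 2 - l * q₁ * b + l ^ 2 * c → a ≠ 0 →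
      q₁ ∈ Ideal.span {l, m} := by
    rintro l m q₁ q₂ hl hl0 hlq ⟨w, hw⟩ ha
    have : l ∣ q₁ * (C a * q₁ + m * w) :=
      ⟨q₁ * b - l * c + q₂ * w, by linear_combination hw⟩
    obtain ⟨k, hk⟩ := ((hl.prime_of_linear hl0).dvd_or_dvd this).resolve_left hlq
    refine Ideal.mem_span_pair.2 ⟨C a⁻¹ * k, - C a⁻¹ * w, ?_⟩
    have hC : C a⁻¹ * C a = (1 : MvPolynomial σ K) := by
      rw [← C_mul, inv_mul_cancel₀ ha, C_1]
    linear_combination - C a⁻¹ * hk + q₁ * hC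
  have hlq₁ : ¬ l ∣ q₁ := fun h => hpencil 1 0 l (Or.inl one_ne_zero) hl 
    (by rw [e₁]; simpa using dvd_add (dvd_mul_left l ξ) h)
  have hmq₂ : ¬ m ∣ q₂ := fun h => hpencil 0 1 m (Or.inr one_ne_zero) hm 
    (by rw [e₂]; simpa using dvd_add (dvd_mul_left m ξ) h)
  by_cases ha : a = 0
  · subst ha
    obtain ⟨w, hw⟩ := hR₁
    rw [C_0] at hw
    have hlw : l ∣ w := by
      have : l ∣ q₁ * (m * w) := ⟨q₁ * b - l * c + q₂ * w, by linear_combination hw⟩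
      exact (pl.dvd_or_dvd ((pl.dvd_or_dvd this).resolve_left hlq₁)).resolve_left hlm
    obtain ⟨γ, rfl⟩ := hlw
    have e3 : l * (c - γ * q₂) = q₁ * (b - γ * m) := by
      apply mul_left_cancel₀ hl0; linear_combination hw
    obtain ⟨δ, hδ⟩ := (pl.dvd_or_dvd (e3 ▸ dvd_mul_right l _)).resolve_left hlq₁
    have e4 : c = γ * q₂ + δ * q₁ := by
      apply mul_left_cancel₀ hl0; linear_combination e3 + q₁ * hδ
    refine Ideal.mem_span_pair.2 ⟨δ, γ, ?_⟩
    rw [e, e₁, e₂, e4, C_0]; linear_combination -ξ * hδ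
  · exfalso
    have hR₂' : m * q₁ - l * q₂ ∣ C a * q₂ ^ 2 - m * q₂ * b + m ^ 2 * c := by
      rwa [← neg_dvd, neg_sub]
    have k₁ := mem_of_ne hl hl0 hlq₁ hR₁ ha
    -- With `a ≠ 0` both `q₁` and `q₂` lie in `(l, m)`, so `Q₁` and `Q₂` do as well.
    have k₂ := mem_of_ne hm hm0 hmq₂ hR₂' ha
    rw [Set.pair_comm] at k₂
    have kl : l ∈ Ideal.span {l, m} := Ideal.subset_span (by simp)
    have km : m ∈ Ideal.span {l, m} := Ideal.subset_span (by simp)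
    refine hlinear l m hl hm hl0 ⟨?_, ?_⟩
    · rw [e₁]; exact add_mem (Ideal.mul_mem_left _ _ kl) k₁
    · rw [e₂]; exact add_mem (Ideal.mul_mem_left _ _ km) k₂

/-- The case of a pencil containing a quadric singular at `p`. -/
theorem exists_mem_of_singular {ι : Type*} {s : Finset ι} (hξ : ξ.IsHomogeneous 1)
    (h1 : eval p ξ = 1) {l q₁ q₂ Q₁ : MvPolynomial σ K} {P : ι → MvPolynomial σ K}
    (hl : l.IsHomogeneous 1) (hl0 : l ≠ 0)
    (hq₁ : q₁.IsHomogeneous 2) (hq₂ : q₂.IsHomogeneous 2)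
    (sl : slide p ξ l = l) (sq₁ : slide p ξ q₁ = q₁) (sq₂ : slide p ξ q₂ = q₂)
    (e₁ : Q₁ = ξ * l + q₁) (hP : ∀ i, (P i).IsHomogeneous 2)
    (hrad : (∏ i ∈ s, P i) ∈ (Ideal.span {Q₁, q₂}).radical)
    (hpencil : ∀ (α β : K) (x : MvPolynomial σ K), α ≠ 0 ∨ β ≠ 0 → x.IsHomogeneous 1 →
      ¬ x ∣ C α * Q₁ + C β * q₂)
    (hlinear : ∀ x y : MvPolynomial σ K, x.IsHomogeneous 1 → y.IsHomogeneous 1 → x ≠ 0 →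
      ¬ (Q₁ ∈ Ideal.span {x, y} ∧ q₂ ∈ Ideal.span {x, y})) :
    ∃ i ∈ s, P i ∈ Ideal.span {Q₁, q₂} := by
  have hq₂' : ∀ x : MvPolynomial σ K, x.IsHomogeneous 1 → ¬ x ∣ q₂ := fun x hx h =>
    hpencil 0 1 x (Or.inr one_ne_zero) hx (by simpa using h)
  have hF : Prime q₂ := hq₂.prime_of_no_linear_factor le_rfl (by norm_num) hq₂'
  have hlF : ¬ q₂ ∣ l := fun h => hl0 (hq₂.eq_zero_of_dvd hl (by norm_num) h)
  rw [Set.pair_comm] at hrad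
  -- The quadrics swap roles: the cone has tangent form `0`, `F` is the cone itself, and `ξ = -q₁ /
  -- l`.
  obtain ⟨i, hi, a, b, c, hb, hc, e, w, hw⟩ := exists_dvd_resultant (l := 0) (q₁ := q₂) hξ h1 hF hlF
    ⟨-l, by ring⟩ (map_zero _) sl sq₂ sq₁ (by ring) e₁ hP hrad
  refine ⟨i, hi, ?_⟩
  obtain ⟨ψ, hψ, hsub, hhom⟩ := exists_retraction hl hl0
  have hψl : ψ l = 0 := (hψ l).2 dvd_rfl
  have hψq₂ : ψ q₂ ≠ 0 := fun h => hq₂' l hl ((hψ _).1 h)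
  -- Modulo `l`, a common linear factor `d` would put both quadrics in `(l, d)`, and a common
  -- quadratic factor would make `l` divide a member of the pencil.
  have hrel : IsRelPrime (ψ q₂) (ψ q₁) := by
    rintro d ⟨g₂, hg₂⟩ ⟨g₁, hg₁⟩
    have hd0 : d ≠ 0 := by rintro rfl; exact hψq₂ (by rw [hg₂, zero_mul])
    obtain ⟨r, t, hrt, hd, hg⟩ := (hg₂ ▸ hhom q₂ 2 hq₂ : (d * g₂).IsHomogeneous 2).exists_of_mul
      (hg₂ ▸ hψq₂)
    have hg₁' : g₁.IsHomogeneous t := hd.right_of_mul hd0 (by rw [hrt, ← hg₁]; exact hhom q₁ 2 hq₁)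
    obtain ⟨u₁, hu₁⟩ := hsub q₁
    obtain ⟨u₂, hu₂⟩ := hsub q₂
    obtain rfl | rfl | rfl : r = 0 ∨ r = 1 ∨ r = 2 := by omega
    · obtain ⟨z, rfl⟩ := hd.exists_eq_C
      exact (isUnit_iff_ne_zero.2 (by rintro rfl; simp at hd0)).map C
    · exfalso
      refine hlinear l d hl hd hl0
        ⟨Ideal.mem_span_pair.2 ⟨ξ + u₁, g₁, ?_⟩, Ideal.mem_span_pair.2 ⟨u₂, g₂, ?_⟩⟩
      · rw [e₁]; linear_combination -hu₁ - hg₁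
      · linear_combination -hu₂ - hg₂
    · exfalso
      obtain rfl : t = 0 := by omega
      obtain ⟨z₁, rfl⟩ := hg₁'.exists_eq_C
      obtain ⟨z₂, rfl⟩ := hg.exists_eq_C
      have hz₂ : z₂ ≠ 0 := by rintro rfl; exact hψq₂ (by rw [hg₂, C_0, mul_zero])
      refine hpencil z₂ (-z₁) l (Or.inl hz₂) hl ⟨C z₂ * ξ + C z₂ * u₁ - C z₁ * u₂, ?_⟩
      rw [e₁, C_neg]
      linear_combination C z₂ * hu₁ + C z₂ * hg₁ - C z₁ * hu₂ - C z₁ * hg₂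
  have hw' := congrArg ψ hw
  simp only [map_add, map_sub, map_mul, map_pow, hψl, algHom_C, algebraMap_eq] at hw'
  have ha : a = 0 := by
    have : ψ q₂ ∣ ψ q₁ * (ψ q₁ * C a) := ⟨ψ w, by linear_combination hw'⟩
    have := hrel.dvd_of_dvd_mul_left (hrel.dvd_of_dvd_mul_left this)
    have := (hhom q₂ 2 hq₂).eq_zero_of_dvd (isHomogeneous_C σ a) (by norm_num) this
    rwa [C_eq_zero] at this
  subst ha
  rw [C_0] at hw hw'
  have : l ∣ w := by
    rw [← hψ]
    have : ψ q₂ * ψ w = 0 := by linear_combination -hw'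
    exact (mul_eq_zero.1 this).resolve_left hψq₂
  obtain ⟨w', rfl⟩ := this
  have hw2 : -(q₁ * b) + l * c = q₂ * w' := by
    apply mul_left_cancel₀ hl0; linear_combination hw
  have hw3 := congrArg ψ hw2
  simp only [map_add, map_mul, map_neg, hψl] at hw3
  have hb0 : ψ b = 0 := by
    have : ψ q₂ ∣ ψ q₁ * ψ b := ⟨-ψ w', by linear_combination -hw3⟩
    exact (hhom q₂ 2 hq₂).eq_zero_of_dvd (hhom b 1 hb) (by norm_num)
      (hrel.dvd_of_dvd_mul_left this)
  obtain ⟨δ, rfl⟩ := (hψ b).1 hb0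
  have : l ∣ w' := by
    rw [← hψ]
    have : ψ q₂ * ψ w' = 0 := by rw [hb0] at hw3; linear_combination -hw3
    exact (mul_eq_zero.1 this).resolve_left hψq₂
  obtain ⟨γ, rfl⟩ := this
  have e4 : c = δ * q₁ + γ * q₂ := by
    apply mul_left_cancel₀ hl0; linear_combination hw2
  refine Ideal.mem_span_pair.2 ⟨δ, γ, ?_⟩
  rw [e, e₁, e4, C_0]; ring

end MvPolynomial

/-! ### Quadratic forms, a smooth common zero, and the conclusion. -/

namespace MvPolynomial

variable {σ K : Type*} [Field K]

theorem IsHomogeneous.exists_linearMap {f : MvPolynomial σ K} (hf : f.IsHomogeneous 1) :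
    ∃ g : (σ → K) →ₗ[K] K, ∀ v, eval v f = g v := by
  refine linear_induction (p := fun f => ∃ g : (σ → K) →ₗ[K] K, ∀ v, eval v f = g v)
    (fun i => ⟨LinearMap.proj i, fun v => by simp⟩) ⟨0, fun v => by simp⟩ ?_ ?_ hf
  · rintro f g ⟨f', hf⟩ ⟨g', hg⟩
    exact ⟨f' + g', fun v => by simp [hf, hg]⟩
  · rintro r f ⟨f', hf⟩
    exact ⟨r • f', fun v => by simp [hf]⟩

theorem IsHomogeneous.exists_quadraticForm {f : MvPolynomial σ K} (hf : f.IsHomogeneous 2) :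
    ∃ q : QuadraticForm K (σ → K), ∀ v, eval v f = q v := by
  refine quadratic_induction (p := fun f => ∃ q : QuadraticForm K (σ → K), ∀ v, eval v f = q v)
    (fun f g hf hg => ?_) ?_ hf
  · obtain ⟨f', hf⟩ := hf.exists_linearMap
    obtain ⟨g', hg⟩ := hg.exists_linearMap
    exact ⟨QuadraticMap.linMulLin f' g', fun v => by simp [hf, hg]⟩
  · rintro f g ⟨f', hf⟩ ⟨g', hg⟩
    exact ⟨f' + g', fun v => by simp [hf, hg]⟩

theorem exists_isHomogeneous_of_linearMap [Fintype σ] (g : (σ → K) →ₗ[K] K) :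
    ∃ f : MvPolynomial σ K, f.IsHomogeneous 1 ∧ ∀ v, eval v f = g v := by
  classical
  refine ⟨∑ i, C (g (Pi.single i 1)) * X i,
    IsHomogeneous.sum _ _ _ fun i _ => (isHomogeneous_X K i).C_mul _, fun v => ?_⟩
  rw [g.pi_apply_eq_sum_univ v]
  have hs : ∀ i, (Pi.single i 1 : σ → K) = fun j => if i = j then 1 else 0 := fun i => by
    ext j; simp [Pi.single_apply, eq_comm]
  simp [hs, mul_comm]

/-- A sum of two squares of linear forms over an algebraically closed field splits. -/
theorem exists_eq_mul_of_eval_eq_sq_add_sq [Fintype σ] [IsAlgClosed K] [Infinite K]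
    {Q : MvPolynomial σ K} (f g : (σ → K) →ₗ[K] K) (h : ∀ v, eval v Q = f v ^ 2 + g v ^ 2) :
    ∃ x y : MvPolynomial σ K, x.IsHomogeneous 1 ∧ y.IsHomogeneous 1 ∧ Q = x * y := by
  obtain ⟨ι, hι⟩ := IsAlgClosed.exists_pow_nat_eq (-1 : K) two_pos
  obtain ⟨x, hx, ex⟩ := exists_isHomogeneous_of_linearMap (f + ι • g)
  obtain ⟨y, hy, ey⟩ := exists_isHomogeneous_of_linearMap (f - ι • g)
  refine ⟨x, y, hx, hy, MvPolynomial.funext fun v => ?_⟩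
  rw [h, map_mul, ex, ey]
  simp only [LinearMap.add_apply, LinearMap.sub_apply, LinearMap.smul_apply, smul_eq_mul]
  linear_combination (g v) ^ 2 * hι

/-- A quadric restricted to a parametrised conic is a binary quartic in `s, t`, which has a
nontrivial zero. -/
theorem exists_quadraticForm_quartic_eq_zero {V : Type*} [AddCommGroup V] [Module K V]
    [IsAlgClosed K] (q : QuadraticForm K V) (u v w : V) :
    ∃ s t : K, (s ≠ 0 ∨ t ≠ 0) ∧ q ((s ^ 2) • u + (s * t) • v + (t ^ 2) • w) = 0 := by
  by_cases hu : q u = 0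
  · exact ⟨1, 0, Or.inl one_ne_zero, by simpa using hu⟩
  let G : Polynomial K := Polynomial.C (q u) * Polynomial.X ^ 4 +
    Polynomial.C (QuadraticMap.polar q u v) * Polynomial.X ^ 3 +
    Polynomial.C (q v + QuadraticMap.polar q u w) * Polynomial.X ^ 2 +
    Polynomial.C (QuadraticMap.polar q v w) * Polynomial.X + Polynomial.C (q w)
  have hdeg : G.degree = 4 := by
    simp only [G]; compute_degree!
  obtain ⟨s, hs⟩ := IsAlgClosed.exists_root G (by rw [hdeg]; norm_num)
  refine ⟨s, 1, Or.inr one_ne_zero, ?_⟩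
  have hs' : q u * s ^ 4 + QuadraticMap.polar q u v * s ^ 3 +
      (q v + QuadraticMap.polar q u w) * s ^ 2 + QuadraticMap.polar q v w * s + q w = 0 := by
    simpa [G] using hs
  rw [QuadraticMap.map_add q, QuadraticMap.map_add q]
  simp only [QuadraticMap.map_smul, QuadraticMap.polar_add_left, QuadraticMap.polar_smul_left,
    QuadraticMap.polar_smul_right, smul_eq_mul]
  linear_combination hs'

theorem weightedSumSquares_three {ι : Type*} [Fintype ι] [DecidableEq ι] (w : ι → K) {i j k : ι}
    (hij : i ≠ j) (hik : i ≠ k) (hjk : j ≠ k) (a b c : K) :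
    QuadraticMap.weightedSumSquares K w (Pi.single i a + Pi.single j b + Pi.single k c) =
      w i * a ^ 2 + w j * b ^ 2 + w k * c ^ 2 := by
  rw [QuadraticMap.weightedSumSquares_apply,
    ← Finset.sum_subset (Finset.subset_univ {i, j, k})]
  · rw [Finset.sum_insert (by simp [hij, hik]), Finset.sum_insert (by simp [hjk]),
      Finset.sum_singleton]
    simp [hij, hik, hjk, hij.symm, hik.symm, hjk.symm]
    ring
  · intro l _ hl
    simp only [Finset.mem_insert, Finset.mem_singleton, not_or] at hl
    simp [hl.1, hl.2.1, hl.2.2]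

/-- Either `Q₁` splits, or it passes through a point common with `Q₂` at which it is smooth. -/
theorem exists_smooth_common_zero [Fintype σ] [IsAlgClosed K] [CharZero K] {Q₁ Q₂ : MvPolynomial σ K}
    (h₁ : Q₁.IsHomogeneous 2) (h₂ : Q₂.IsHomogeneous 2)
    (hsplit : ∀ x y : MvPolynomial σ K, x.IsHomogeneous 1 → y.IsHomogeneous 1 → Q₁ ≠ x * y) :
    ∃ p v : σ → K, eval p Q₁ = 0 ∧ eval p Q₂ = 0 ∧ eval (fun i => p i + v i) Q₁ ≠ eval v Q₁ := by
  classical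
  obtain ⟨q₁, hq₁⟩ := h₁.exists_quadraticForm
  obtain ⟨q₂, hq₂⟩ := h₂.exists_quadraticForm
  have : Invertible (2 : K) := invertibleOfNonzero two_ne_zero
  obtain ⟨w, ⟨e⟩⟩ := q₁.equivalent_weightedSumSquares
  have he : ∀ v, q₁ v = QuadraticMap.weightedSumSquares K w (e v) := fun v => (e.map_app v).symm
  have he' : ∀ x, q₁ (e.symm x) = QuadraticMap.weightedSumSquares K w x := fun x =>
    e.symm.map_app x
  have hadd : ∀ x y, e.symm (x + y) = e.symm x + e.symm y := fun x y =>
    map_add e.symm.toLinearEquiv x y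
  have hsmul : ∀ (r : K) x, e.symm (r • x) = r • e.symm x := fun r x =>
    map_smul e.symm.toLinearEquiv r x
  have hsqrt : ∀ i, ∃ r, r ^ 2 = w i := fun i => IsAlgClosed.exists_pow_nat_eq (w i) two_pos
  choose r hr using hsqrt
  let S : Finset _ := {i | w i ≠ 0}
  by_cases hS : 2 < S.card
  · obtain ⟨i, j, k, hi, hj, hk, hij, hik, hjk⟩ := Finset.two_lt_card_iff.1 hS
    obtain ⟨ι, hι⟩ := IsAlgClosed.exists_pow_nat_eq (-1 : K) two_pos
    have hwi : w i ≠ 0 := by simpa [S] using hi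
    have hwj : w j ≠ 0 := by simpa [S] using hj
    have hwk : w k ≠ 0 := by simpa [S] using hk
    have hri : r i ≠ 0 := fun h => hwi (by rw [← hr, h]; simp)
    have hrj : r j ≠ 0 := fun h => hwj (by rw [← hr, h]; simp)
    have hrk : r k ≠ 0 := fun h => hwk (by rw [← hr, h]; simp)
    -- In coordinates scaled by `r`, this is the conic `(s² - t², 2st, ι(s² + t²))` on `x² + y² + z²
    -- = 0`, pulled back to lie on `Q₁`.
    obtain ⟨s, t, hst, h0⟩ := exists_quadraticForm_quartic_eq_zero q₂
      (e.symm (Pi.single i (r i)⁻¹ + Pi.single j 0 + Pi.single k (ι * (r k)⁻¹)))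
      (e.symm (Pi.single i 0 + Pi.single j (2 * (r j)⁻¹) + Pi.single k 0))
      (e.symm (Pi.single i (-(r i)⁻¹) + Pi.single j 0 + Pi.single k (ι * (r k)⁻¹)))
    let a := (s ^ 2 - t ^ 2) * (r i)⁻¹
    let b := 2 * (s * t) * (r j)⁻¹
    let c := ι * (s ^ 2 + t ^ 2) * (r k)⁻¹
    have hp : (s ^ 2) • (e.symm (Pi.single i (r i)⁻¹ + Pi.single j 0 + Pi.single k (ι * (r k)⁻¹)))
        + (s * t) • (e.symm (Pi.single i 0 + Pi.single j (2 * (r j)⁻¹) + Pi.single k 0))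
        + (t ^ 2) • (e.symm (Pi.single i (-(r i)⁻¹) + Pi.single j 0 + Pi.single k (ι * (r k)⁻¹)))
        = e.symm (Pi.single i a + Pi.single j b + Pi.single k c) := by
      rw [← hsmul, ← hsmul, ← hsmul, ← hadd, ← hadd]
      congr 1
      simp only [smul_add, ← Pi.single_smul, smul_eq_mul, Pi.single_zero, add_zero,
        zero_add, a, b, c]
      have e1 : (s ^ 2 - t ^ 2) * (r i)⁻¹ = s ^ 2 * (r i)⁻¹ + t ^ 2 * -(r i)⁻¹ := by ring
      have e2 : 2 * (s * t) * (r j)⁻¹ = s * t * (2 * (r j)⁻¹) := by ring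
      have e3 : ι * (s ^ 2 + t ^ 2) * (r k)⁻¹ = s ^ 2 * (ι * (r k)⁻¹) + t ^ 2 * (ι * (r k)⁻¹) := by
        ring
      rw [e1, e2, e3, Pi.single_add, Pi.single_add]
      abel
    rw [hp] at h0
    have hq : ∀ x y z : K, q₁ (e.symm (Pi.single i x + Pi.single j y + Pi.single k z)) =
        w i * x ^ 2 + w j * y ^ 2 + w k * z ^ 2 := fun x y z => by
      rw [he', weightedSumSquares_three w hij hik hjk]
    have hzero : w i * a ^ 2 + w j * b ^ 2 + w k * c ^ 2 = 0 := by
      simp only [a, b, c, ← hr]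
      field_simp
      linear_combination (s ^ 2 + t ^ 2) ^ 2 * hι
    -- A nonzero coordinate with nonzero weight makes the polar form of `Q₁` at the point nonzero,
    -- that is, the point smooth.
    have hab : a ≠ 0 ∨ b ≠ 0 := by
      by_contra! H
      have ha : s ^ 2 - t ^ 2 = 0 := (mul_eq_zero.1 H.1).resolve_right (inv_ne_zero hri)
      have hb : s * t = 0 := by
        have := (mul_eq_zero.1 H.2).resolve_right (inv_ne_zero hrj)
        exact (mul_eq_zero.1 this).resolve_left two_ne_zero
      rcases mul_eq_zero.1 hb with h | h <;> subst h <;> simp at ha <;> simp [ha] at hst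
    have fin : ∀ x y : K, w i * a * x + w j * b * y ≠ 0 →
        ∃ p v : σ → K, eval p Q₁ = 0 ∧ eval p Q₂ = 0 ∧
          eval (fun i => p i + v i) Q₁ ≠ eval v Q₁ := by
      intro x y hxy
      refine ⟨_, e.symm (Pi.single i x + Pi.single j y + Pi.single k 0), ?_,
        (hq₂ _).trans h0, ?_⟩
      · rw [hq₁, hq, hzero]
      · change eval (e.symm _ + e.symm _) Q₁ ≠ _
        rw [← hadd]
        have : Pi.single i a + Pi.single j b + Pi.single k c +
          (Pi.single i x + Pi.single j y + Pi.single k 0) =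
          (Pi.single i (a + x) + Pi.single j (b + y) + Pi.single k (c + 0) :
            Fin (Module.finrank K (σ → K)) → K) := by
          simp only [Pi.single_add]; abel
        rw [this, hq₁, hq₁, hq, hq]
        intro H
        apply hxy
        have : (2 : K) * (w i * a * x + w j * b * y) = 0 := by linear_combination H - hzero
        exact (mul_eq_zero.1 this).resolve_left two_ne_zero
    rcases hab with h | h
    · exact fin 1 0 (by simpa using ⟨hwi, h⟩)
    · exact fin 0 1 (by simpa using ⟨hwj, h⟩)
  · exfalso
    let f : Fin (Module.finrank K (σ → K)) → (σ → K) →ₗ[K] K := fun i =>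
      r i • (LinearMap.proj i ∘ₗ e.toLinearEquiv.toLinearMap)
    have hQ : ∀ v, eval v Q₁ = ∑ i ∈ S, f i v ^ 2 := by
      intro v
      rw [hq₁, he, QuadraticMap.weightedSumSquares_apply, ← Finset.sum_subset S.subset_univ]
      · refine Finset.sum_congr rfl fun i _ => ?_
        change w i • (e v i * e v i) = (r i * e v i) ^ 2
        rw [mul_pow, hr, smul_eq_mul, pow_two]
      · intro i _ hi
        have : w i = 0 := by simpa [S] using hi
        rw [this, zero_smul]
    -- At most two squares remain, so `Q₁` would split.
    have : ∃ f g : (σ → K) →ₗ[K] K, ∀ v, eval v Q₁ = f v ^ 2 + g v ^ 2 := by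
      obtain h | h | h : S.card = 0 ∨ S.card = 1 ∨ S.card = 2 := by omega
      · exact ⟨0, 0, fun v => by rw [hQ, Finset.card_eq_zero.1 h]; simp⟩
      · obtain ⟨i, hi⟩ := Finset.card_eq_one.1 h
        exact ⟨f i, 0, fun v => by rw [hQ, hi]; simp⟩
      · obtain ⟨i, j, hij, hi⟩ := Finset.card_eq_two.1 h
        exact ⟨f i, f j, fun v => by rw [hQ, hi, Finset.sum_pair hij]⟩
    obtain ⟨f, g, hfg⟩ := this
    obtain ⟨x, y, hx, hy, hxy⟩ := exists_eq_mul_of_eval_eq_sq_add_sq f g hfg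
    exact hsplit x y hx hy hxy

/-- If no quadric of the pencil has a linear factor and the base locus contains no linear subspace
of codimension two, then the ideal of the pencil is prime as far as quadrics are concerned. -/
theorem exists_mem_span_of_prod_mem_radical [Fintype σ] [IsAlgClosed K] [CharZero K] {ι : Type*}
    {s : Finset ι} {Q₁ Q₂ : MvPolynomial σ K} {P : ι → MvPolynomial σ K}
    (h₁ : Q₁.IsHomogeneous 2) (h₂ : Q₂.IsHomogeneous 2) (hP : ∀ i, (P i).IsHomogeneous 2)
    (hrad : (∏ i ∈ s, P i) ∈ (Ideal.span {Q₁, Q₂}).radical)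
    (hpencil : ∀ (α β : K) (x : MvPolynomial σ K), α ≠ 0 ∨ β ≠ 0 → x.IsHomogeneous 1 →
      ¬ x ∣ C α * Q₁ + C β * Q₂)
    (hlinear : ∀ x y : MvPolynomial σ K, x.IsHomogeneous 1 → y.IsHomogeneous 1 → x ≠ 0 →
      ¬ (Q₁ ∈ Ideal.span {x, y} ∧ Q₂ ∈ Ideal.span {x, y})) :
    ∃ i ∈ s, P i ∈ Ideal.span {Q₁, Q₂} := by
  obtain ⟨p, v, hp₁, hp₂, hv⟩ := exists_smooth_common_zero h₁ h₂ fun x y hx _ hxy =>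
    hpencil 1 0 x (Or.inl one_ne_zero) hx (by simp [hxy])
  obtain ⟨j, hj⟩ : ∃ j, p j ≠ 0 := by
    by_contra! H
    exact hv (by simp [H])
  have hξ : (C (p j)⁻¹ * X j : MvPolynomial σ K).IsHomogeneous 1 := (isHomogeneous_X K j).C_mul _
  have h1 : eval p (C (p j)⁻¹ * X j : MvPolynomial σ K) = 1 := by simp [hj]
  generalize (C (p j)⁻¹ * X j : MvPolynomial σ K) = ξ at hξ h1
  obtain ⟨l, q₁, hl, hq₁, sl, sq₁, e₁⟩ := exists_expansion hξ h1 h₁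
  obtain ⟨m, q₂, hm, hq₂, sm, sq₂, e₂⟩ := exists_expansion hξ h1 h₂
  rw [hp₁, C_0, zero_mul, zero_add] at e₁
  rw [hp₂, C_0, zero_mul, zero_add] at e₂
  -- With `l = 0`, `Q₁ = q₁` would be invariant under translation by `p`, against smoothness.
  have hl0 : l ≠ 0 := by
    rintro rfl
    apply hv
    rw [mul_zero, zero_add] at e₁
    rw [e₁, ← sq₁, eval_slide, eval_slide]
    have hξv : eval (fun i => p i + v i) ξ = 1 + eval v ξ := by
      obtain ⟨g, hg⟩ := hξ.exists_linearMap
      rw [← h1, hg, hg, hg, ← map_add]; rfl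
    congr 2
    ext i
    rw [hξv]; ring
  by_cases hlm : l ∣ m
  · obtain ⟨r, rfl⟩ := hlm
    obtain ⟨r, rfl⟩ := (hl.right_of_mul hl0 (b := 0) hm).exists_eq_C
    have eQ : Q₂ = (q₂ - C r * q₁) + C r * Q₁ := by rw [e₂, e₁]; ring
    have hspan : Ideal.span {Q₁, Q₂} = Ideal.span {Q₁, q₂ - C r * q₁} := by
      rw [eQ, Ideal.span_pair_add_mul_left]
    rw [hspan] at hrad ⊢
    refine exists_mem_of_singular hξ h1 hl hl0 hq₁ (hq₂.sub (hq₁.C_mul r)) sl sq₁ ?_ e₁ hP hrad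
      ?_ ?_
    · rw [map_sub, map_mul, sq₁, sq₂, algHom_C, algebraMap_eq]
    · intro α β x hαβ hx hd
      -- Coordinates of the same pencil member after substituting `q₂ - r q₁ = Q₂ - r Q₁`.
      refine hpencil (α - β * r) β x ?_ hx ?_
      · by_contra! H
        obtain ⟨H, rfl⟩ := H
        simp at H
        simp [H] at hαβ
      · convert hd using 1
        rw [eQ, C_sub, C_mul]; ring
    · rintro x y hx hy hx0 ⟨k₁, k₂⟩
      exact hlinear x y hx hy hx0 ⟨k₁, eQ ▸ add_mem k₂ (Ideal.mul_mem_left _ _ k₁)⟩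
  · exact exists_mem_of_isRelPrime_tangents hξ h1 hl hm hl0 hlm hq₁ hq₂ sl sm sq₁ sq₂ e₁ e₂ hP hrad
      hpencil hlinear

theorem exists_linear_mul_of_dvd {Q x : MvPolynomial σ K} (hQ : Q.IsHomogeneous 2) (hQ0 : Q ≠ 0)
    (hx : x.IsHomogeneous 1) (h : x ∣ Q) :
    ∃ y : MvPolynomial σ K, y.IsHomogeneous 1 ∧ x ≠ 0 ∧ y ≠ 0 ∧ Q = x * y := by
  obtain ⟨y, rfl⟩ := h
  have hx0 := left_ne_zero_of_mul hQ0
  exact ⟨y, hx.right_of_mul hx0 hQ, hx0, right_ne_zero_of_mul hQ0, rfl⟩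

end MvPolynomial

open MvPolynomial in
theorem corollary3p9 {K : Type*} [Field K] [IsAlgClosed K] [CharZero K] (n k : ℕ)
    (Q₁ Q₂ : MvPolynomial (Fin n) K) (P : Fin k → MvPolynomial (Fin n) K)
    (hQ₁ : Q₁.IsHomogeneous 2) (hQ₂ : Q₂.IsHomogeneous 2) (hP : ∀ i, (P i).IsHomogeneous 2)
    (hrad : (∏ i, P i) ∈ (Ideal.span {Q₁, Q₂}).radical) :
    (∃ i, P i ∈ Submodule.span K {Q₁, Q₂}) ∨
    (∃ (α β : K) (x y : MvPolynomial (Fin n) K),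
      (α ≠ 0 ∨ β ≠ 0) ∧ x.IsHomogeneous 1 ∧ y.IsHomogeneous 1 ∧ x ≠ 0 ∧ y ≠ 0 ∧
      α • Q₁ + β • Q₂ = x * y) ∨
    (∃ x y : MvPolynomial (Fin n) K, x.IsHomogeneous 1 ∧ y.IsHomogeneous 1 ∧
      Q₁ ∈ Ideal.span {x, y} ∧ Q₂ ∈ Ideal.span {x, y} ∧ (∏ i, P i) ∈ Ideal.span {x, y}) := by
  by_contra! H
  obtain ⟨H1, H2, H3⟩ := H
  have hideal : ∀ i, P i ∉ Ideal.span {Q₁, Q₂} := fun i hi =>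
    H1 i ((hP i).mem_span_pair hQ₁ hQ₂ hi)
  have hcomb : ∀ (α β : K) (x : MvPolynomial (Fin n) K), α ≠ 0 ∨ β ≠ 0 → x.IsHomogeneous 1 →
      C α * Q₁ + C β * Q₂ ≠ 0 → ¬ x ∣ C α * Q₁ + C β * Q₂ := by
    intro α β x hαβ hx h0 hd
    obtain ⟨y, hy, hx0, hy0, e⟩ :=
      exists_linear_mul_of_dvd ((hQ₁.C_mul α).add (hQ₂.C_mul β)) h0 hx hd
    exact H2 α β x y hαβ hx hy hx0 hy0 (by rw [smul_eq_C_mul, smul_eq_C_mul, e])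
  -- a pencil spanned by a single quadric
  have hprincipal : ∀ Q : MvPolynomial (Fin n) K, Q.IsHomogeneous 2 →
      Ideal.span {Q₁, Q₂} = Ideal.span {Q} →
      (Q ≠ 0 → ∀ x : MvPolynomial (Fin n) K, x.IsHomogeneous 1 → ¬ x ∣ Q) → False := by
    intro Q hQ hspan hfac
    have hex : ∃ i, Q ∣ P i := by
      obtain ⟨N, hN⟩ := hrad
      rw [hspan, Ideal.mem_span_singleton] at hN
      by_cases h0 : Q = 0
      · rw [h0, zero_dvd_iff] at hN
        obtain ⟨i, -, hi⟩ := Finset.prod_eq_zero_iff.1 (eq_zero_of_pow_eq_zero hN)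
        exact ⟨i, hi ▸ dvd_zero _⟩
      · have hp := hQ.prime_of_no_linear_factor le_rfl (by norm_num) (hfac h0)
        obtain ⟨i, -, hi⟩ := (hp.dvd_finsetProd_iff _).1 (hp.dvd_of_dvd_pow hN)
        exact ⟨i, hi⟩
    obtain ⟨i, hi⟩ := hex
    exact hideal i (by rw [hspan, Ideal.mem_span_singleton]; exact hi)
  by_cases hdep : ∃ α β : K, (α ≠ 0 ∨ β ≠ 0) ∧ C α * Q₁ + C β * Q₂ = 0
  · obtain ⟨α, β, hαβ, e⟩ := hdep
    by_cases hβ : β = 0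
    · subst hβ
      have hα : α ≠ 0 := by simpa using hαβ
      have h0 : Q₁ = 0 := by simpa [hα] using e
      refine hprincipal Q₂ hQ₂ (by simp [h0, Ideal.span_insert]) fun hne x hx hd => ?_
      exact hcomb 0 1 x (Or.inr one_ne_zero) hx (by simpa using hne) (by simpa using hd)
    · have hd : Q₂ = C (-(β⁻¹ * α)) * Q₁ := by
        have hC : C β⁻¹ * C β = (1 : MvPolynomial (Fin n) K) := by
          rw [← C_mul, inv_mul_cancel₀ hβ, C_1]
        rw [C_neg, C_mul]
        linear_combination C β⁻¹ * e - Q₂ * hC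
      have hspan : Ideal.span {Q₁, Q₂} = Ideal.span {Q₁} := by
        refine le_antisymm (Ideal.span_le.2 ?_) (Ideal.span_mono (by simp))
        rintro f (rfl | rfl)
        · exact Ideal.mem_span_singleton_self _
        · exact Ideal.mem_span_singleton.2 (hd ▸ dvd_mul_left _ _)
      refine hprincipal Q₁ hQ₁ hspan fun hne x hx hd => ?_
      exact hcomb 1 0 x (Or.inl one_ne_zero) hx (by simpa using hne) (by simpa using hd)
  · push Not at hdep
    obtain ⟨i, -, hi⟩ := exists_mem_span_of_prod_mem_radical hQ₁ hQ₂ hP hrad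
      (fun α β x hαβ hx => hcomb α β x hαβ hx (hdep α β hαβ)) fun x y hx hy hx0 hxy => by
        refine H3 x y hx hy hxy.1 hxy.2 ?_
        obtain ⟨N, hN⟩ := hrad
        refine mem_span_pair_of_pow_mem hx hx0 hy (N := N) (Ideal.span_le.2 ?_ hN)
        rintro f (rfl | rfl)
        exacts [hxy.1, hxy.2]
    exact hideal i hi
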